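/- Let $\Omega$ be a nonempty set and $\Sigma$ an algebra of subsets of $\Omega$. A signed charge on $\Sigma$ is a finitely additive function $\mu\colon\Sigma\to\mathbb R$; let $\mathbf{ba}$ be the vector space of bounded signed charges on $\Sigma$, ordered setwise ($\mu\le\nu$ if and only if $\mu(A)\le\nu(A)$ for all $A\in\Sigma$). Let $P$ be a probability charge on $\Sigma$ (a nonnegative charge with $P(\Omega)=1$) that is convex-ranged, i.e. $\{P(B)\mid B\in\Sigma,\ B\subseteq A\}=[0,P(A)]$ for every $A\in\Sigma$. Let $v\colon\Sigma\to\mathbb R$ be a game ($v(\varnothing)=0$) that is $P$-invariant ($v(A)=v(B)$ whenever $A,B\in\Sigma$ and $P(A)=P(B)$) and superadditive ($v(A\cup B)\ge v(A)+v(B)$ for all disjoint $A,B\in\Sigma$). Let $\mathcal{LA}_v=\{\mu\in\mathbf{ba}\mid \mu(A)\le v(A)\text{ for all }A\in\Sigma\}$ be the loose anticore of $v$, and let $\mathrm{up}(\mathcal{LA}_v)(A)=\sup_{\mu\in\mathcal{LA}_v}\mu(A)$ for $A\in\Sigma$. Then the following statements are equivalent: 1. $\mathcal{LA}_v\neq\varnothing$.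 2. $\sup\mathcal{LA}_v$ (the least upper bound) exists in $\mathbf{ba}$. 3. $\{a\in\mathbb R\mid aP\le v\text{ setwise}\}\neq\varnothing$. 4. $a^\star:=\sup\{a\in\mathbb R\mid aP\le v\text{ setwise}\}$, taken in $[-\infty,\infty]$, is a real number. In this case, $$\mathcal{LA}_v=\{\mu\in\mathbf{ba}\mid\mu\le a^\star P\}\qquad\text{and}\qquad\sup\mathcal{LA}_v=a^\star P.$$ Moreover, $\mathrm{up}(\mathcal{LA}_v)$ is then a (real-valued) subadditive game, i.e. it vanishes at $\varnothing$ and $-\mathrm{up}(\mathcal{LA}_v)$ is superadditive, and $a^\star P$ is the unique $\mu\in\mathbf{ba}$ with $\mathrm{up}(\mathcal{LA}_v)\le\mu\le v$ setwise. -/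

import Mathlib

/-! Algebras of events on `Ω` are Boolean subalgebras `S` of the power set `Set Ω`; in `S`, the
operations `⊔`, `⊓`, complement, `⊥`, `⊤` are union, intersection, complement, `∅` and `Ω`, and a set
function on the algebra is a map `S → ℝ`. -/

namespace ChargeGame

variable {Ω : Type*} {S : BooleanSubalgebra (Set Ω)}

/-- A signed charge: a finitely additive real set function. -/
def IsCharge (μ : S → ℝ) : Prop :=
  ∀ A B : S, Disjoint (A : Set Ω) (B : Set Ω) → μ (A ⊔ B) = μ A + μ B

/-- A probability charge: a nonnegative charge with total mass one. -/
structure IsProbabilityCharge (P : S → ℝ) : Prop where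
  isCharge : IsCharge P
  nonneg : ∀ A, 0 ≤ P A
  top_eq_one : P ⊤ = 1

/-- Convex range: for each event `A`, the values `P B` of the subevents `B ⊆ A` fill `[0, P A]`. -/
def IsConvexRanged (P : S → ℝ) : Prop :=
  ∀ A : S, {x : ℝ | ∃ B : S, (B : Set Ω) ⊆ (A : Set Ω) ∧ P B = x} = Set.Icc 0 (P A)

variable (S) in
/-- The vector space `ba` of bounded signed charges on the algebra `S`. Its order is the one
inherited from `S → ℝ`, that is, the setwise order. -/
def ba : Submodule ℝ (S → ℝ) where
  carrier := {μ | IsCharge μ ∧ ∃ C : ℝ, ∀ A, |μ A| ≤ C}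
  zero_mem' := ⟨fun _ _ _ => by simp, 0, fun _ => by simp⟩
  add_mem' := by
    rintro μ ν ⟨hμ, C, hC⟩ ⟨hν, D, hD⟩
    refine ⟨fun A B h => ?_, C + D, fun A => ?_⟩
    · simp only [Pi.add_apply, hμ A B h, hν A B h]
      ring
    · exact (abs_add_le _ _).trans (add_le_add (hC A) (hD A))
  smul_mem' := by
    rintro c μ ⟨hμ, C, hC⟩
    refine ⟨fun A B h => ?_, |c| * C, fun A => ?_⟩
    · simp only [Pi.smul_apply, smul_eq_mul, hμ A B h]
      ring
    · simp only [Pi.smul_apply, smul_eq_mul, abs_mul]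
      exact mul_le_mul_of_nonneg_left (hC A) (abs_nonneg c)

/-- A probability charge is bounded. -/
theorem IsProbabilityCharge.mem_ba {P : S → ℝ} (hP : IsProbabilityCharge P) : P ∈ ba S := by
  refine ⟨hP.isCharge, 1, fun A => ?_⟩
  have hd : Disjoint (A : Set Ω) ((Aᶜ : S) : Set Ω) := by
    rw [BooleanSubalgebra.val_compl]
    exact disjoint_compl_right
  have h := hP.isCharge A Aᶜ hd
  rw [sup_compl_eq_top, hP.top_eq_one] at h
  rw [abs_of_nonneg (hP.nonneg A)]
  linarith [hP.nonneg Aᶜ]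

/-- A probability charge, seen as an element of `ba`. -/
def IsProbabilityCharge.toBa {P : S → ℝ} (hP : IsProbabilityCharge P) : ba S := ⟨P, hP.mem_ba⟩

/-- A game: a set function vanishing at the empty set. -/
def IsGame (v : S → ℝ) : Prop := v ⊥ = 0

/-- `P`-invariance of a set function. -/
def IsInvariant (P v : S → ℝ) : Prop := ∀ A B : S, P A = P B → v A = v B

def IsSuperadditive (v : S → ℝ) : Prop :=
  ∀ A B : S, Disjoint (A : Set Ω) (B : Set Ω) → v A + v B ≤ v (A ⊔ B)

def IsSubadditive (v : S → ℝ) : Prop := IsSuperadditive (-v)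

/-- The loose anticore of `v`: all bounded signed charges lying setwise below `v`. -/
def looseAnticore (v : S → ℝ) : Set (ba S) := {μ | (μ : S → ℝ) ≤ v}

/-- The set of all real `a` with `aP ≤ v` setwise. -/
def minorantScalars (P v : S → ℝ) : Set ℝ := {a | a • P ≤ v}

/-- `a⋆`, the supremum of all real `a` with `aP ≤ v`, taken in the extended reals. -/
noncomputable def aStar (P v : S → ℝ) : EReal :=
  sSup ((fun a : ℝ => (a : EReal)) '' minorantScalars P v)

/-- The upper envelope of a set of bounded signed charges, with values in the extended reals. -/
noncomputable def upperEnvelope (R : Set (ba S)) (A : S) : EReal :=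
  ⨆ μ ∈ R, (((μ : S → ℝ) A : ℝ) : EReal)

/-- `μ` is sandwiched between the upper envelope of the loose anticore of `v`, and `v` itself. -/
def IsSandwiched (v : S → ℝ) (μ : ba S) : Prop :=
  ∀ A : S, upperEnvelope (looseAnticore v) A ≤ (((μ : S → ℝ) A : ℝ) : EReal) ∧
    (μ : S → ℝ) A ≤ v A

end ChargeGame

namespace ChargeGame

section

variable {Ω : Type*} {S : BooleanSubalgebra (Set Ω)} {P v μ : S → ℝ}

/-! Everything follows once `a⋆P` is known to be the greatest element of the loose anticore. Convex
range cuts an event into `n` pieces of equal probability, and invariance gives `v` the same value on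
all of them, so a charge `μ ≤ v` satisfies `μ B ≤ n * v T` when `P B = n * P T`
(`le_nat_mul_of_le`). Boundedness of `μ` then bounds `v` below by a multiple of `P`; superadditivity
makes `v` nearly `a⋆P` on suitable small events, which forces `μ ≤ a⋆P` (`le_smul_of_le`). -/

theorem IsConvexRanged.exists_disjoint_sup (hP : IsCharge P) (hc : IsConvexRanged P) (A : S)
    {x : ℝ} (hx0 : 0 ≤ x) (hx : x ≤ P A) :
    ∃ B C : S, Disjoint (B : Set Ω) (C : Set Ω) ∧ B ⊔ C = A ∧ P B = x ∧ P C = P A - x := by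
  have hmem : x ∈ {x : ℝ | ∃ B : S, (B : Set Ω) ⊆ (A : Set Ω) ∧ P B = x} := by
    rw [hc A]
    exact ⟨hx0, hx⟩
  obtain ⟨B, hBA, hB⟩ := hmem
  have hle : B ≤ A := hBA
  have hd : Disjoint (B : Set Ω) ((A ⊓ Bᶜ : S) : Set Ω) := by
    rw [Set.disjoint_left]
    rintro ω hω ⟨-, h⟩
    rw [BooleanSubalgebra.val_compl] at h
    exact h hω
  have hs : B ⊔ A ⊓ Bᶜ = A := by
    rw [sup_inf_left, sup_compl_eq_top, inf_top_eq, sup_eq_right.2 hle]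
  refine ⟨B, A ⊓ Bᶜ, hd, hs, hB, ?_⟩
  have h := hP B (A ⊓ Bᶜ) hd
  rw [hs] at h
  linarith

theorem IsCharge.map_bot (hP : IsCharge P) : P ⊥ = 0 := by
  have h := hP ⊥ ⊥ (by simp)
  rw [sup_idem] at h
  linarith

theorem IsCharge.isSuperadditive (h : IsCharge μ) : IsSuperadditive μ :=
  fun A B hd => (h A B hd).ge

theorem IsCharge.neg (h : IsCharge μ) : IsCharge (-μ) := by
  intro A B hd
  simp only [Pi.neg_apply, h A B hd]
  ring

theorem IsProbabilityCharge.le_one (hP : IsProbabilityCharge P) (A : S) : P A ≤ 1 := by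
  have hd : Disjoint (A : Set Ω) ((Aᶜ : S) : Set Ω) := by
    rw [BooleanSubalgebra.val_compl]
    exact disjoint_compl_right
  have h := hP.isCharge A Aᶜ hd
  rw [sup_compl_eq_top, hP.top_eq_one] at h
  linarith [hP.nonneg Aᶜ]

theorem IsInvariant.eq_zero (hP : IsCharge P) (hv : IsGame v) (hinv : IsInvariant P v) {A : S}
    (hA : P A = 0) : v A = 0 :=
  (hinv A ⊥ (hA.trans hP.map_bot.symm)).trans hv

/-- A superadditive function that is at least `c` on all events of probability `t`, and nonnegative
on null events, is at least `n * c` on all events of probability `n * t`. -/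
theorem IsSuperadditive.nat_mul_le (hP : IsCharge P) (hc : IsConvexRanged P)
    (hv : IsSuperadditive v) {t c : ℝ} (ht : 0 ≤ t) (h0 : ∀ A, P A = 0 → 0 ≤ v A)
    (hct : ∀ A, P A = t → c ≤ v A) (n : ℕ) (B : S) (hB : P B = n * t) : n * c ≤ v B := by
  induction n generalizing B with
  | zero => simpa using h0 B (by simpa using hB)
  | succ n ih =>
    push_cast at hB ⊢
    have hnt : 0 ≤ (n : ℝ) * t := by positivity
    obtain ⟨C, D, hd, rfl, hC, hD⟩ :=
      hc.exists_disjoint_sup hP B ht (by rw [hB]; linarith)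
    have h1 := hct C hC
    have h2 := ih D (by rw [hD, hB]; ring)
    linarith [hv C D hd]

theorem le_nat_mul_of_le (hP : IsProbabilityCharge P) (hc : IsConvexRanged P) (hv : IsGame v)
    (hinv : IsInvariant P v) (hμ : IsCharge μ) (hle : μ ≤ v) (n : ℕ) (B T : S)
    (hB : P B = n * P T) : μ B ≤ n * v T := by
  have h := hμ.neg.isSuperadditive.nat_mul_le (c := -v T) hP.isCharge hc (hP.nonneg T)
    (fun A hA => ?_) (fun A hA => ?_) n B hB
  · simp only [Pi.neg_apply] at h
    linarith
  · have := hle A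
    rw [hinv.eq_zero hP.isCharge hv hA] at this
    simpa using this
  · have := hle A
    rw [hinv A T hA] at this
    simpa using this

/-- As many copies of `T` as fit in `Ω` have total probability `n * P T ≥ 1/2`, so `-C ≤ n * v T`
gives `v T ≥ -2C * P T`. -/
theorem minorantScalars_nonempty (hP : IsProbabilityCharge P) (hc : IsConvexRanged P)
    (hv : IsGame v) (hinv : IsInvariant P v) (hμ : μ ∈ ba S) (hle : μ ≤ v) :
    (minorantScalars P v).Nonempty := by
  obtain ⟨hμ, C, hC⟩ := hμ
  have hC0 : 0 ≤ C := (abs_nonneg _).trans (hC ⊥)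
  refine ⟨-(2 * C), fun T => ?_⟩
  simp only [Pi.smul_apply, smul_eq_mul]
  rcases (hP.nonneg T).eq_or_lt' with h0 | h0
  · rw [h0, hinv.eq_zero hP.isCharge hv h0, mul_zero]
  have h1 : 1 ≤ 1 / P T := by rw [le_div_iff₀ h0, one_mul]; exact hP.le_one T
  set n := ⌊1 / P T⌋₊
  have hn1 : (1 : ℝ) ≤ n := by exact_mod_cast (Nat.one_le_floor_iff _).2 h1
  have hn : n * P T ≤ 1 := (le_div_iff₀ h0).1 (Nat.floor_le (by positivity))
  have hn' : 1 < (n + 1) * P T := (div_lt_iff₀ h0).1 (Nat.lt_floor_add_one _)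
  obtain ⟨B, -, -, -, hB, -⟩ := hc.exists_disjoint_sup hP.isCharge ⊤ (x := n * P T)
    (by positivity) (by rwa [hP.top_eq_one])
  have h := le_nat_mul_of_le hP hc hv hinv hμ hle n B T hB
  have hb := (abs_le.1 (hC B)).1
  have h2 : 1 ≤ 2 * (n * P T) := by nlinarith
  have h3 : C * 1 ≤ C * (2 * (n * P T)) := mul_le_mul_of_nonneg_left h2 hC0
  refine le_of_mul_le_mul_left (a := (n : ℝ)) ?_ (by linarith)
  linarith

/-- If `a` is the greatest scalar with `aP ≤ v`, then `aP` dominates every charge below `v`. -/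
theorem le_smul_of_le (hP : IsProbabilityCharge P) (hc : IsConvexRanged P) (hv : IsGame v)
    (hinv : IsInvariant P v) (hsup : IsSuperadditive v) {a : ℝ}
    (ha : IsGreatest (minorantScalars P v) a) (hμ : IsCharge μ) (hle : μ ≤ v) : μ ≤ a • P := by
  intro A
  simp only [Pi.smul_apply, smul_eq_mul]
  rcases (hP.nonneg A).eq_or_lt' with h0 | h0
  · rw [h0, mul_zero, ← hinv.eq_zero hP.isCharge hv h0]
    exact hle A
  refine le_of_forall_pos_le_add fun ε hε => ?_
  obtain ⟨δ, hδ, hδε⟩ : ∃ δ : ℝ, 0 < δ ∧ 2 * P A * δ = ε :=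
    ⟨ε / (2 * P A), by positivity, by field_simp⟩
  obtain ⟨T₀, hT₀⟩ : ∃ T, v T < (a + δ) * P T := by
    by_contra! h
    exact absurd (ha.2 (show a + δ ∈ minorantScalars P v from h)) (by linarith)
  have hT₀0 : 0 < P T₀ := by
    refine (hP.nonneg T₀).lt_of_ne' fun h => ?_
    rw [h, hinv.eq_zero hP.isCharge hv h, mul_zero] at hT₀
    exact lt_irrefl _ hT₀
  -- One of `m` equal parts of `T₀` is no larger than `A`, and by superadditivity it inherits the
  -- near-equality from `T₀`.
  obtain ⟨m, hm⟩ := exists_nat_gt (P T₀ / P A)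
  have hm0 : (0 : ℝ) < m := lt_trans (by positivity) hm
  have hm1 : (1 : ℝ) ≤ m := by exact_mod_cast (Nat.cast_pos.1 hm0)
  obtain ⟨T, -, -, -, hT, -⟩ := hc.exists_disjoint_sup hP.isCharge T₀ (x := P T₀ / m)
    (by positivity) (div_le_self hT₀0.le hm1)
  have hT0 : 0 < P T := by rw [hT]; positivity
  have hTA : P T ≤ P A := by
    rw [hT, div_le_iff₀ hm0]
    rw [div_lt_iff₀ h0] at hm
    linarith
  have hT₀T : P T₀ = m * P T := by rw [hT]; field_simp
  have hvT : v T ≤ (a + δ) * P T := by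
    have h := hsup.nat_mul_le (c := v T) hP.isCharge hc hT0.le
      (fun B hB => (hinv.eq_zero hP.isCharge hv hB).ge) (fun B hB => (hinv B T hB).ge) m T₀ hT₀T
    refine le_of_mul_le_mul_left (a := (m : ℝ)) ?_ hm0
    rw [hT₀T] at hT₀
    linarith
  -- A `k`-th of `A` fits inside `T`, and rounding up costs at most `P T ≤ P A`.
  set k := ⌈P A / P T⌉₊
  have hk : P A ≤ k * P T := (div_le_iff₀ hT0).1 (Nat.le_ceil _)
  have hk' : (k : ℝ) * P T ≤ 2 * P A := by
    have := Nat.ceil_lt_add_one (a := P A / P T) (by positivity)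
    have h := mul_lt_mul_of_pos_right this hT0
    rw [add_mul, div_mul_cancel₀ _ hT0.ne'] at h
    linarith
  have hk0 : (0 : ℝ) < k := by
    by_contra! h
    nlinarith
  obtain ⟨B, D, hd, hBD, hB, hD⟩ := hc.exists_disjoint_sup hP.isCharge T (x := P A / k)
    (by positivity) (by rwa [div_le_iff₀ hk0, mul_comm])
  have hAB : P A = k * P B := by rw [hB]; field_simp
  have h1 := le_nat_mul_of_le hP hc hv hinv hμ hle k A B hAB
  -- The near-equality on `T` passes to `B`, since `v` is at least `a • P` on the rest `D`. The
  -- excess stays `δ * P T`, and `k` copies of it total at most `ε`.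
  have h2 := hsup B D hd
  rw [hBD] at h2
  have h3 : a * P D ≤ v D := ha.1 D
  rw [hD, ← hB] at h3
  have h4 : k * v B ≤ k * (a * P B + δ * P T) :=
    mul_le_mul_of_nonneg_left (by linarith) hk0.le
  have h5 : δ * (k * P T) ≤ δ * (2 * P A) := mul_le_mul_of_nonneg_left hk' hδ.le
  rw [hAB] at h5 hδε ⊢
  linarith

/-- The supremum is attained because each event with `P A > 0` imposes the closed condition `c ≤ v A
/ P A`, and null events impose none. -/
theorem isGreatest_of_aStar_eq (hP : IsProbabilityCharge P) (hv : IsGame v)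
    (hinv : IsInvariant P v) {a : ℝ} (ha : aStar P v = a) :
    IsGreatest (minorantScalars P v) a := by
  refine ⟨fun A => ?_, fun c hcv => ?_⟩
  · simp only [Pi.smul_apply, smul_eq_mul]
    rcases (hP.nonneg A).eq_or_lt' with h0 | h0
    · rw [h0, hinv.eq_zero hP.isCharge hv h0, mul_zero]
    have h : aStar P v ≤ ((v A / P A : ℝ) : EReal) := by
      refine sSup_le ?_
      rintro _ ⟨c, hc, rfl⟩
      exact EReal.coe_le_coe_iff.2 ((le_div_iff₀ h0).2 (hc A))
    rw [ha, EReal.coe_le_coe_iff, le_div_iff₀ h0] at h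
    exact h
  · have h : (c : EReal) ≤ aStar P v := le_sSup ⟨c, hcv, rfl⟩
    rwa [ha, EReal.coe_le_coe_iff] at h

theorem exists_aStar_eq (hP : IsProbabilityCharge P) (h : (minorantScalars P v).Nonempty) :
    ∃ a : ℝ, aStar P v = a := by
  obtain ⟨c, hc⟩ := h
  have h1 : (c : EReal) ≤ aStar P v := le_sSup ⟨c, hc, rfl⟩
  have h2 : aStar P v ≤ (v ⊤ : EReal) := by
    refine sSup_le ?_
    rintro _ ⟨b, hb, rfl⟩
    have := hb ⊤
    simp only [Pi.smul_apply, smul_eq_mul, hP.top_eq_one, mul_one] at this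
    exact EReal.coe_le_coe_iff.2 this
  exact ⟨_, (EReal.coe_toReal (ne_top_of_le_ne_top (EReal.coe_ne_top _) h2)
    (ne_bot_of_le_ne_bot (EReal.coe_ne_bot _) h1)).symm⟩

theorem upperEnvelope_eq_of_isGreatest {R : Set (ba S)} {ν : ba S} (h : IsGreatest R ν) (A : S) :
    upperEnvelope R A = ((ν : S → ℝ) A : EReal) :=
  le_antisymm (iSup₂_le fun _ hμ => EReal.coe_le_coe_iff.2 (h.2 hμ A))
    (le_iSup₂ (f := fun (μ : ba S) (_ : μ ∈ R) => (((μ : S → ℝ) A : ℝ) : EReal)) ν h.1)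

end

end ChargeGame

theorem mainTheorem8 {Ω : Type*} (S : BooleanSubalgebra (Set Ω)) (P v : S → ℝ)
    (hP : ChargeGame.IsProbabilityCharge P) (hPconv : ChargeGame.IsConvexRanged P)
    (hgame : ChargeGame.IsGame v) (hinv : ChargeGame.IsInvariant P v)
    (hsuper : ChargeGame.IsSuperadditive v) :
    List.TFAE
      [(ChargeGame.looseAnticore v).Nonempty,
        ∃ μ : ChargeGame.ba S, IsLUB (ChargeGame.looseAnticore v) μ,
        (ChargeGame.minorantScalars P v).Nonempty,
        ∃ a : ℝ, ChargeGame.aStar P v = (a : EReal)] ∧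
    ∀ a : ℝ, ChargeGame.aStar P v = (a : EReal) →
      ChargeGame.looseAnticore v = {μ : ChargeGame.ba S | μ ≤ a • hP.toBa} ∧
      IsLUB (ChargeGame.looseAnticore v) (a • hP.toBa) ∧
      (∃ w : S → ℝ, ChargeGame.IsGame w ∧ ChargeGame.IsSubadditive w ∧
        ∀ A : S, ChargeGame.upperEnvelope (ChargeGame.looseAnticore v) A = (w A : EReal)) ∧
      ChargeGame.IsSandwiched v (a • hP.toBa) ∧
      ∀ μ : ChargeGame.ba S, ChargeGame.IsSandwiched v μ → μ = a • hP.toBa := by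
  have greatest : ∀ a : ℝ, ChargeGame.aStar P v = (a : EReal) →
      IsGreatest (ChargeGame.looseAnticore v) (a • hP.toBa) := fun a ha => by
    have h := ChargeGame.isGreatest_of_aStar_eq hP hgame hinv ha
    exact ⟨h.1, fun μ hμ => ChargeGame.le_smul_of_le hP hPconv hgame hinv hsuper h μ.2.1 hμ⟩
  refine ⟨?_, fun a ha => ?_⟩
  · tfae_have 1 → 3 := fun ⟨μ, hμ⟩ =>
      ChargeGame.minorantScalars_nonempty hP hPconv hgame hinv μ.2 hμ
    tfae_have 3 → 4 := ChargeGame.exists_aStar_eq hP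
    tfae_have 4 → 2 := fun ⟨a, ha⟩ => ⟨_, (greatest a ha).isLUB⟩
    tfae_have 2 → 1 := by
      rintro ⟨μ, hμ⟩
      -- A least upper bound of the empty set would be a least element of `ba`, but subtracting `P`
      -- gives something smaller.
      by_contra hne
      rw [Set.not_nonempty_iff_eq_empty] at hne
      rw [hne, isLUB_empty_iff] at hμ
      have h : (μ : S → ℝ) ⊤ ≤ (μ : S → ℝ) ⊤ - P ⊤ := hμ (μ - hP.toBa) ⊤
      rw [hP.top_eq_one] at h
      linarith
    tfae_finish
  · have hg := greatest a ha
    have hup := ChargeGame.upperEnvelope_eq_of_isGreatest hg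
    refine ⟨?_, hg.isLUB, ⟨_, (a • hP.toBa).2.1.map_bot,
      (a • hP.toBa).2.1.neg.isSuperadditive, hup⟩, fun A => ⟨(hup A).le, hg.1 A⟩, fun μ hμ => ?_⟩
    · ext μ
      exact ⟨fun h => hg.2 h, fun h => le_trans (show (μ : S → ℝ) ≤ _ from h) hg.1⟩
    · refine le_antisymm (hg.2 fun A => (hμ A).2) fun A => ?_
      have h := (hμ A).1
      rw [hup A] at h
      exact EReal.coe_le_coe_iff.1 h
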